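/- **Proposition 5.3 (Askey–Wilson second structure relation).** Let $q\in\mathbb{C}\setminus\{0\}$ be not a root of unity (e.g. $0<q<1$), fix a square root $q^{1/2}$ of $q$, and put $\gamma_m=\dfrac{q^{m/2}-q^{-m/2}}{q^{1/2}-q^{-1/2}}$ for $m\in\mathbb{Z}$. Let $a,b,c,d\in\mathbb{C}$ with $a\neq 0$ and $ab\,q^k,\ ac\,q^k,\ ad\,q^k,\ abcd\,q^k\neq 1$ for all integers $k\ge 0$. For $n\ge 0$ let $P_n(x)=P_n(x;a,b,c,d\,|\,q)=\dfrac{p_n(x;a,b,c,d\,|\,q)}{2^n(abcd\,q^{n-1};q)_n}$ be the monic Askey–Wilson polynomial, where $$\frac{a^n p_n(x;a,b,c,d\,|\,q)}{(ab,ac,ad;q)_n}={}_4\phi_3\left(\begin{matrix}q^{-n},\,abcd\,q^{n-1},\,ae^{-i\theta},\,ae^{i\theta}\\ ab,\,ac,\,ad\end{matrix};q,q\right),\qquad x=\cos\theta,$$ and let $P_m=0$ for $m<0$. Let $\mathcal{D}_q$ be the Askey–Wilson operator, which maps a polynomial $f$ in $x$ to the polynomial $$\mathcal{D}_qf(x)=\frac{\breve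 f(q^{1/2}e^{i\theta})-\breve f(q^{-1/2}e^{i\theta})}{(e^{i\theta}-e^{-i\theta})(q^{1/2}-q^{-1/2})/2},\qquad \breve f(z)=f\Big(\frac{z+z^{-1}}{2}\Big),\quad x=\cos\theta .$$ For $n\in\mathbb{Z}$ put $$C_n(a,b,c,d)=\frac{a(1-q^n)(1-bcq^{n-1})(1-bdq^{n-1})(1-dcq^{n-1})}{(1-abcdq^{2n-2})(1-abcdq^{2n-1})}$$ (a product containing a factor $C_0$ is read as $0$). Then for every $n\ge 0$ there are numbers $b_{n,n+j}$, $-2\le j\le 2$, with $$\gamma_{n+2}\gamma_{n+1}b_{n,n+2}=1,$$ $$-2\gamma_{n+1}\gamma_{n}b_{n,n+1}=C_n(b,aq,c,d)+C_n(a,b,c,d)+C_n(d,cq,aq,bq)+C_n(c,d,aq,bq),$$ $$\begin{aligned}4\gamma_{n}\gamma_{n-1}b_{n,n}={}&\big(C_n(b,aq,c,d)+C_n(a,b,c,d)\big)\big(C_{n-1}(d,cq,aq,bq)+C_{n-1}(c,d,aq,bq)\big)\\&+C_n(c,d,aq,bq)C_{n-1}(d,cq,aq,bq)+C_n(a,b,c,d)C_{n-1}(b,aq,c,d),\end{aligned}$$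 $$\begin{aligned}-8\gamma_{n-1}\gamma_{n-2}b_{n,n-1}={}&\big(C_n(b,aq,c,d)+C_n(a,b,c,d)\big)C_{n-1}(c,d,aq,bq)C_{n-2}(d,cq,aq,bq)\\&+C_n(a,b,c,d)C_{n-1}(b,aq,c,d)\big(C_{n-2}(d,cq,aq,bq)+C_{n-2}(c,d,aq,bq)\big),\end{aligned}$$ $$16\gamma_{n-2}\gamma_{n-3}b_{n,n-2}=C_n(a,b,c,d)C_{n-1}(b,aq,c,d)C_{n-2}(c,d,aq,bq)C_{n-3}(d,cq,aq,bq),$$ and for any such numbers $$P_n(x;a,b,c,d\,|\,q)=\sum_{j=-2}^{2}b_{n,n+j}\,\mathcal{D}_q^2P_{n+j}(x;a,b,c,d\,|\,q).$$ -/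

import Mathlib

open Polynomial

namespace AskeyWilson

noncomputable section

/-! Throughout, `q` is the base, `r` is a fixed square root `q^{1/2}` of it, and `z` stands for
`e^{iθ}` (any nonzero complex number), so that `x = cos θ = (z + z⁻¹) / 2`. -/

/-- The point `x = cos θ = (z + z⁻¹) / 2` with `z = e^{iθ}`. -/
def lattice (z : ℂ) : ℂ := (z + z⁻¹) / 2

/-- The `q`-shifted factorial `(x; q)_k = ∏_{j < k} (1 - x q ^ j)`. -/
def qPoch (q x : ℂ) (k : ℕ) : ℂ := ∏ j ∈ Finset.range k, (1 - x * q ^ j)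

/-- The basic hypergeometric series `₄φ₃(a₁, a₂, a₃, a₄; b₁, b₂, b₃; q, t)`. -/
def phi43 (a₁ a₂ a₃ a₄ b₁ b₂ b₃ q t : ℂ) : ℂ :=
  ∑' k : ℕ, qPoch q a₁ k * qPoch q a₂ k * qPoch q a₃ k * qPoch q a₄ k /
    (qPoch q b₁ k * qPoch q b₂ k * qPoch q b₃ k) * (t ^ k / qPoch q q k)

/-- The polynomial in `x = cos θ` that equals `(a e^{-iθ}, a e^{iθ}; q)_k`. -/
def basisPoly (q a : ℂ) (k : ℕ) : ℂ[X] :=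
  ∏ j ∈ Finset.range k, (1 - C (2 * a * q ^ j) * X + C (a ^ 2 * q ^ (2 * j)))

/-- The Askey-Wilson polynomial `p_n(x; a, b, c, d | q)`, as a polynomial in `x`:
`p_n = (ab, ac, ad; q)_n / a ^ n` times
`₄φ₃(q^{-n}, abcd q^{n-1}, a e^{-iθ}, a e^{iθ}; ab, ac, ad; q, q)`; the series stops at `k = n`
because of the factor `(q^{-n}; q)_k`. See `eval_askeyWilson`. -/
def askeyWilson (q a b c d : ℂ) (n : ℕ) : ℂ[X] :=
  C (qPoch q (a * b) n * qPoch q (a * c) n * qPoch q (a * d) n / a ^ n) *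
    ∑ k ∈ Finset.range (n + 1),
      C (qPoch q (q ^ (-(n : ℤ))) k * qPoch q (a * b * c * d * q ^ ((n : ℤ) - 1)) k /
          (qPoch q (a * b) k * qPoch q (a * c) k * qPoch q (a * d) k) *
          (q ^ k / qPoch q q k)) * basisPoly q a k

/-- The monic Askey-Wilson polynomial
`P_n = p_n / (2 ^ n (abcd q^{n-1}; q)_n)` for `n ≥ 0`, with the convention `P_n = 0` for `n < 0`.
See `monic_monicAW`. -/
def monicAW (q a b c d : ℂ) : ℤ → ℂ[X]
  | Int.ofNat n =>
      C ((2 ^ n * qPoch q (a * b * c * d * q ^ ((n : ℤ) - 1)) n)⁻¹) * askeyWilson q a b c d n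
  | Int.negSucc _ => 0

/-- For every polynomial `f`, the divided difference of `f` is again a polynomial in `x`. -/
theorem exists_dividedDifference (r : ℂ) (f : ℂ[X]) :
    ∃ g : ℂ[X], ∀ z : ℂ, z ≠ 0 →
      g.eval (lattice z) * ((z - z⁻¹) * (r - r⁻¹) / 2) =
        f.eval (lattice (r * z)) - f.eval (lattice (r⁻¹ * z)) := by
  by_cases hr : r = 0
  · exact ⟨0, fun z _ => by simp [hr]⟩
  have key : ∀ n : ℕ, ∃ g : ℂ[X], ∀ z : ℂ, z ≠ 0 →
      g.eval (lattice z) * ((z - z⁻¹) * (r - r⁻¹) / 2) =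
        lattice (r * z) ^ n - lattice (r⁻¹ * z) ^ n := by
    intro n
    induction n using Nat.twoStepInduction with
    | zero => exact ⟨0, fun z _ => by simp⟩
    | one =>
      refine ⟨1, fun z hz => ?_⟩
      simp only [lattice, eval_one]
      field_simp
      ring
    | more n h1 h2 =>
      obtain ⟨g1, h1⟩ := h1
      obtain ⟨g2, h2⟩ := h2
      refine ⟨C (r + r⁻¹) * X * g2 - (X ^ 2 + C (((r - r⁻¹) / 2) ^ 2)) * g1, fun z hz => ?_⟩
      have e1 : lattice (r * z) + lattice (r⁻¹ * z) = (r + r⁻¹) * lattice z := by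
        simp only [lattice]
        field_simp
        ring
      have e2 : lattice (r * z) * lattice (r⁻¹ * z) =
          lattice z ^ 2 + ((r - r⁻¹) / 2) ^ 2 := by
        simp only [lattice]
        field_simp
        ring
      have h1z := h1 z hz
      have h2z := h2 z hz
      simp only [eval_sub, eval_mul, eval_add, eval_C, eval_X, eval_pow]
      rw [← e1, ← e2, sub_mul, mul_assoc, h2z, mul_assoc, h1z]
      ring
  induction f using Polynomial.induction_on' with
  | add f1 f2 h1 h2 =>
    obtain ⟨g1, h1⟩ := h1
    obtain ⟨g2, h2⟩ := h2
    refine ⟨g1 + g2, fun z hz => ?_⟩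
    simp only [eval_add, add_mul, h1 z hz, h2 z hz]
    ring
  | monomial n s =>
    obtain ⟨g, h⟩ := key n
    refine ⟨C s * g, fun z hz => ?_⟩
    simp only [eval_mul, eval_C, eval_monomial, mul_assoc, h z hz]
    ring

/-- The Askey-Wilson operator `𝒟_q` on polynomials in `x = cos θ`: the polynomial `𝒟_q f` with
`(𝒟_q f)(x) = (f(x(q^{1/2} e^{iθ})) - f(x(q^{-1/2} e^{iθ}))) /`
`((e^{iθ} - e^{-iθ}) (q^{1/2} - q^{-1/2}) / 2)`, where `x(z) = (z + z⁻¹) / 2` and `r = q^{1/2}`.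
See `eval_awD`. -/
def awD (r : ℂ) (f : ℂ[X]) : ℂ[X] := Classical.choose (exists_dividedDifference r f)

/-- The defining formula of the Askey-Wilson operator, wherever its denominator is nonzero. -/
theorem eval_awD (r : ℂ) (hr0 : r ≠ 0) (hr : r ^ 2 ≠ 1) (f : ℂ[X]) (z : ℂ) (hz0 : z ≠ 0)
    (hz : z ^ 2 ≠ 1) :
    (awD r f).eval (lattice z) =
      (f.eval (lattice (r * z)) - f.eval (lattice (r⁻¹ * z))) /
        ((z - z⁻¹) * (r - r⁻¹) / 2) := by
  have aux : ∀ w : ℂ, w ≠ 0 → w ^ 2 ≠ 1 → w - w⁻¹ ≠ 0 := by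
    intro w hw0 hw h
    apply hw
    have : w * (w - w⁻¹) = 0 := by rw [h, mul_zero]
    rw [mul_sub, mul_inv_cancel₀ hw0] at this
    linear_combination this
  rw [eq_div_iff]
  · exact Classical.choose_spec (exists_dividedDifference r f) z hz0
  · exact div_ne_zero (mul_ne_zero (aux z hz0 hz) (aux r hr0 hr)) two_ne_zero

/-- `γ_n = (q^{n/2} - q^{-n/2}) / (q^{1/2} - q^{-1/2})`, with `r = q^{1/2}`. -/
def gammaAW (r : ℂ) (n : ℤ) : ℂ := (r ^ n - r ^ (-n)) / (r - r⁻¹)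

/-- The coefficient
`C_n(a, b, c, d) = a (1 - q^n) (1 - bc q^{n-1}) (1 - bd q^{n-1}) (1 - dc q^{n-1}) /`
`((1 - abcd q^{2n-2}) (1 - abcd q^{2n-1}))`. -/
def coeffC (q : ℂ) (n : ℤ) (a b c d : ℂ) : ℂ :=
  a * (1 - q ^ n) * (1 - b * c * q ^ (n - 1)) * (1 - b * d * q ^ (n - 1)) *
      (1 - d * c * q ^ (n - 1)) /
    ((1 - a * b * c * d * q ^ (2 * n - 2)) * (1 - a * b * c * d * q ^ (2 * n - 1)))

/-- The equations that give the coefficients `β m = b_{n,m}`, `m = n - 2, …, n + 2`, of the second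
structure relation. -/
structure IsSecondStructureCoeff (q r a b c d : ℂ) (n : ℤ) (β : ℤ → ℂ) : Prop where
  add_two : gammaAW r (n + 2) * gammaAW r (n + 1) * β (n + 2) = 1
  add_one : -2 * gammaAW r (n + 1) * gammaAW r n * β (n + 1) =
    coeffC q n b (a * q) c d + coeffC q n a b c d + coeffC q n d (c * q) (a * q) (b * q) +
      coeffC q n c d (a * q) (b * q)
  same : 4 * gammaAW r n * gammaAW r (n - 1) * β n =
    (coeffC q n b (a * q) c d + coeffC q n a b c d) *
        (coeffC q (n - 1) d (c * q) (a * q) (b * q) + coeffC q (n - 1) c d (a * q) (b * q)) +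
      coeffC q n c d (a * q) (b * q) * coeffC q (n - 1) d (c * q) (a * q) (b * q) +
      coeffC q n a b c d * coeffC q (n - 1) b (a * q) c d
  sub_one : -8 * gammaAW r (n - 1) * gammaAW r (n - 2) * β (n - 1) =
    (coeffC q n b (a * q) c d + coeffC q n a b c d) * coeffC q (n - 1) c d (a * q) (b * q) *
        coeffC q (n - 2) d (c * q) (a * q) (b * q) +
      coeffC q n a b c d * coeffC q (n - 1) b (a * q) c d *
        (coeffC q (n - 2) d (c * q) (a * q) (b * q) + coeffC q (n - 2) c d (a * q) (b * q))
  sub_two : 16 * gammaAW r (n - 2) * gammaAW r (n - 3) * β (n - 2) =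
    coeffC q n a b c d * coeffC q (n - 1) b (a * q) c d * coeffC q (n - 2) c d (a * q) (b * q) *
      coeffC q (n - 3) d (c * q) (a * q) (b * q)

theorem eval_basisPoly (q a z : ℂ) (hz : z ≠ 0) (k : ℕ) :
    (basisPoly q a k).eval (lattice z) = qPoch q (a * z⁻¹) k * qPoch q (a * z) k := by
  simp only [basisPoly, qPoch, eval_prod, ← Finset.prod_mul_distrib]
  refine Finset.prod_congr rfl fun j _ => ?_
  simp only [eval_add, eval_sub, eval_mul, eval_one, eval_C, eval_X, lattice]
  field_simp
  ring

/-- The hypergeometric representation of the Askey-Wilson polynomials. -/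
theorem eval_askeyWilson (q a b c d z : ℂ) (hq : q ≠ 0) (hz : z ≠ 0) (n : ℕ) :
    (askeyWilson q a b c d n).eval (lattice z) =
      qPoch q (a * b) n * qPoch q (a * c) n * qPoch q (a * d) n / a ^ n *
        phi43 (q ^ (-(n : ℤ))) (a * b * c * d * q ^ ((n : ℤ) - 1)) (a * z⁻¹) (a * z)
          (a * b) (a * c) (a * d) q q := by
  have hvan : ∀ k, n < k → qPoch q (q ^ (-(n : ℤ))) k = 0 := by
    intro k hk
    refine Finset.prod_eq_zero (Finset.mem_range.2 hk) ?_
    rw [← zpow_natCast, ← zpow_add₀ hq]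
    simp
  rw [phi43, tsum_eq_sum (s := Finset.range (n + 1))]
  · simp only [askeyWilson, eval_mul, eval_C, eval_finsetSum, eval_basisPoly q a z hz]
    congr 1
    refine Finset.sum_congr rfl fun k _ => ?_
    ring
  · intro k hk
    rw [hvan k (by simpa using hk)]
    simp

theorem natDegree_basisPoly_le (q a : ℂ) (k : ℕ) : (basisPoly q a k).natDegree ≤ k := by
  refine (natDegree_prod_le _ _).trans ?_
  refine (Finset.sum_le_card_nsmul _ _ 1 fun j _ => ?_).trans (by simp)
  compute_degree

theorem coeff_basisPoly (q a : ℂ) (k : ℕ) :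
    (basisPoly q a k).coeff k = ∏ j ∈ Finset.range k, (-(2 * a * q ^ j)) := by
  induction k with
  | zero => simp [basisPoly]
  | succ k ih =>
    rw [basisPoly, Finset.prod_range_succ, Finset.prod_range_succ, ← basisPoly,
      coeff_mul_add_eq_of_natDegree_le (natDegree_basisPoly_le q a k) (by compute_degree), ih]
    have h : ∀ s t : ℂ, (1 - C s * X + C t : ℂ[X]).coeff 1 = -s := fun s t => by
      simp [coeff_one, coeff_C]
    rw [h]

/-- The polynomials `P_n` are indeed monic of degree `n`. -/
theorem monic_monicAW (q a b c d : ℂ) (hq0 : q ≠ 0) (hq : ∀ k : ℕ, 1 ≤ k → q ^ k ≠ 1)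
    (ha : a ≠ 0) (hab : ∀ k : ℕ, a * b * q ^ k ≠ 1) (hac : ∀ k : ℕ, a * c * q ^ k ≠ 1)
    (had : ∀ k : ℕ, a * d * q ^ k ≠ 1) (habcd : ∀ k : ℕ, a * b * c * d * q ^ k ≠ 1) (n : ℕ) :
    (monicAW q a b c d n).Monic ∧ (monicAW q a b c d n).natDegree = n := by
  have hne : ∀ t : ℂ, (∀ k : ℕ, t * q ^ k ≠ 1) → ∀ k, qPoch q t k ≠ 0 := fun t ht k =>
    Finset.prod_ne_zero_iff.2 fun j _ => sub_ne_zero.2 (ht j).symm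
  have hqq : qPoch q q n ≠ 0 := hne q (fun k => by
    rw [← pow_succ']; exact hq _ (by omega)) n
  have hlead : qPoch q (a * b * c * d * q ^ ((n : ℤ) - 1)) n ≠ 0 := by
    rcases n with _ | n
    · simp [qPoch]
    · refine hne _ (fun k => ?_) _
      have : ((n + 1 : ℕ) : ℤ) - 1 = (n : ℤ) := by push_cast; ring
      rw [this, zpow_natCast, mul_assoc, ← pow_add]
      exact habcd _
  have hrev : qPoch q (q ^ (-(n : ℤ))) n * (q ^ n * ∏ j ∈ Finset.range n, (-(2 * a * q ^ j))) =
      qPoch q q n * (2 ^ n * a ^ n) := by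
    have h1 : qPoch q (q ^ (-(n : ℤ))) n = ∏ j ∈ Finset.range n, (1 - (q ^ (j + 1))⁻¹) := by
      rw [qPoch, ← Finset.prod_range_reflect]
      refine Finset.prod_congr rfl fun j hj => ?_
      have hj := Finset.mem_range.1 hj
      rw [← zpow_natCast, ← zpow_add₀ hq0, ← zpow_natCast, ← zpow_neg]
      congr 2
      push_cast [Nat.sub_sub, Nat.cast_sub (show 1 + j ≤ n by omega)]
      ring
    have h2 : ∀ (t : ℂ), t ^ n = ∏ j ∈ Finset.range n, t := fun t => by simp
    rw [h1, h2 q, h2 2, h2 a, qPoch]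
    simp only [← Finset.prod_mul_distrib]
    refine Finset.prod_congr rfl fun j _ => ?_
    field_simp
    ring
  have hdeg : (monicAW q a b c d n).natDegree ≤ n := by
    change (C _ * (C _ * ∑ k ∈ Finset.range (n + 1), C _ * basisPoly q a k)).natDegree ≤ n
    refine (natDegree_C_mul_le _ _).trans ((natDegree_C_mul_le _ _).trans ?_)
    refine natDegree_sum_le_of_forall_le _ _ fun k hk => ?_
    refine (natDegree_C_mul_le _ _).trans ((natDegree_basisPoly_le q a k).trans ?_)
    have := Finset.mem_range.1 hk
    omega
  have hcoeff : (monicAW q a b c d n).coeff n = 1 := by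
    change (C _ * askeyWilson q a b c d n).coeff n = 1
    rw [askeyWilson, coeff_C_mul, coeff_C_mul, finsetSum_coeff, Finset.sum_range_succ,
      Finset.sum_eq_zero, zero_add, coeff_C_mul, coeff_basisPoly]
    · have hA := hne _ hab n
      have hB := hne _ hac n
      have hD := hne _ had n
      generalize ∏ j ∈ Finset.range n, (-(2 * a * q ^ j)) = t at hrev ⊢
      field_simp
      linear_combination hrev
    · intro k hk
      rw [coeff_C_mul, coeff_eq_zero_of_natDegree_lt, mul_zero]
      exact (natDegree_basisPoly_le q a k).trans_lt (Finset.mem_range.1 hk)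
  have hm := monic_of_natDegree_le_of_coeff_eq_one n hdeg hcoeff
  exact ⟨hm, le_antisymm hdeg (le_natDegree_of_ne_zero (by rw [hcoeff]; exact one_ne_zero))⟩

end

end AskeyWilson

open AskeyWilson

namespace AskeyWilson

/-! Both sides are expansions in the polynomials with all four parameters multiplied by q. On the
one hand, 𝒟_q lowers the degree by one and multiplies each parameter by q^{1/2} (`awD_monicAW`), so
𝒟_q² P_m is γ_m γ_{m-1} P_{m-2}(aq, bq, cq, dq). On the other hand, multiplying a single parameter
by q costs only one lower-degree term: P_m(a, b, c, d) = P_m(aq, b, c, d) - ½ C_m(a, b, c, d)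
P_{m-1}(aq, b, c, d), and similarly for b, c, d (`monicAW_shift_a` and its companions). Shifting a,
b, c, d in turn writes P_n through P_{n-i}(aq, bq, cq, dq), 0 ≤ i ≤ 4, and the defining equations of
the b_{n,n+j} say exactly that the coefficients of the two expansions agree.

All contiguous relations are proved on coefficients in the basis (ae^{-iθ}, ae^{iθ}; q)_k. The basis
depends on a alone, so the shift of b is a termwise identity, c and d follow by symmetry, and the
shift of a needs a change of basis (`basisPoly_shift`). -/

/-- The coefficient of `basisPoly q a k` in the monic Askey-Wilson polynomial of degree `n`. -/
noncomputable def monicCoeff (q a b c d : ℂ) (n k : ℕ) : ℂ :=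
  (2 ^ n * qPoch q (a * b * c * d * q ^ ((n : ℤ) - 1)) n)⁻¹ *
    (qPoch q (a * b) n * qPoch q (a * c) n * qPoch q (a * d) n / a ^ n) *
    (qPoch q (q ^ (-(n : ℤ))) k * qPoch q (a * b * c * d * q ^ ((n : ℤ) - 1)) k /
      (qPoch q (a * b) k * qPoch q (a * c) k * qPoch q (a * d) k) * (q ^ k / qPoch q q k))

/-- The parameter conditions under which the Askey-Wilson polynomials are defined. -/
structure Admissible (q a b c d : ℂ) : Prop where
  ne_zero : a ≠ 0
  ab : ∀ k : ℕ, a * b * q ^ k ≠ 1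
  ac : ∀ k : ℕ, a * c * q ^ k ≠ 1
  ad : ∀ k : ℕ, a * d * q ^ k ≠ 1
  abcd : ∀ k : ℕ, a * b * c * d * q ^ k ≠ 1

/-! ### q-shifted factorials and the basis expansion of P_n. -/

theorem qPoch_succ (q x : ℂ) (k : ℕ) : qPoch q x (k + 1) = qPoch q x k * (1 - x * q ^ k) :=
  Finset.prod_range_succ _ _

theorem qPoch_succ' (q x : ℂ) (k : ℕ) : qPoch q x (k + 1) = (1 - x) * qPoch q (x * q) k := by
  rw [qPoch, Finset.prod_range_succ', mul_comm, qPoch]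
  simp only [pow_zero, mul_one, pow_succ', mul_assoc]

theorem qPoch_shift (q x : ℂ) (k : ℕ) :
    (1 - x) * qPoch q (x * q) k = qPoch q x k * (1 - x * q ^ k) := by
  rw [← qPoch_succ', qPoch_succ]

theorem qPoch_ne_zero {q x : ℂ} (h : ∀ k : ℕ, x * q ^ k ≠ 1) (k : ℕ) : qPoch q x k ≠ 0 :=
  Finset.prod_ne_zero_iff.2 fun j _ => sub_ne_zero.2 (h j).symm

theorem qPoch_neg_eq_zero {q : ℂ} (hq0 : q ≠ 0) {n k : ℕ} (h : n < k) :
    qPoch q (q ^ (-(n : ℤ))) k = 0 := by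
  refine Finset.prod_eq_zero (Finset.mem_range.2 h) ?_
  rw [← zpow_natCast, ← zpow_add₀ hq0]
  simp

theorem monicCoeff_eq_zero {q : ℂ} (hq0 : q ≠ 0) (a b c d : ℂ) {n k : ℕ} (h : n < k) :
    monicCoeff q a b c d n k = 0 := by
  rw [monicCoeff, qPoch_neg_eq_zero hq0 h, zero_mul, zero_div, zero_mul, mul_zero]

/-- The terms with k > n vanish, so any range beyond n is allowed; polynomials of different degrees
can then be compared over one common range. -/
theorem monicAW_eq_sum {q : ℂ} (hq0 : q ≠ 0) (a b c d : ℂ) {n N : ℕ} (h : n < N) :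
    monicAW q a b c d n =
      ∑ k ∈ Finset.range N, C (monicCoeff q a b c d n k) * basisPoly q a k := by
  rw [← Finset.sum_subset (Finset.range_mono (Nat.succ_le_of_lt h))]
  · change C _ * (C _ * ∑ k ∈ Finset.range (n + 1), C _ * basisPoly q a k) = _
    rw [← mul_assoc, ← C_mul, Finset.mul_sum]
    refine Finset.sum_congr rfl fun k _ => ?_
    rw [← mul_assoc, ← C_mul, monicCoeff]
  · intro k _ hk
    rw [monicCoeff_eq_zero hq0 _ _ _ _ (by simpa using hk), C_0, zero_mul]

theorem monicAW_neg (q a b c d : ℂ) {m : ℤ} (h : m < 0) : monicAW q a b c d m = 0 := by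
  obtain ⟨k, rfl⟩ := Int.eq_negSucc_of_lt_zero h
  rfl

theorem monicAW_zero (q a b c d : ℂ) : monicAW q a b c d 0 = 1 := by
  change C _ * (C _ * ∑ k ∈ Finset.range (0 + 1), C _ * basisPoly q a k) = _
  simp [qPoch, basisPoly]

theorem monicAW_swap_bc (q a b c d : ℂ) : monicAW q a b c d = monicAW q a c b d := by
  funext m
  rcases m with n | n
  · change C _ * (C _ * _) = C _ * (C _ * _)
    rw [show a * c * b * d = a * b * c * d by ring]
    simp only [mul_comm (qPoch q (a * b) _) (qPoch q (a * c) _)]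
  · rfl

theorem monicAW_swap_cd (q a b c d : ℂ) : monicAW q a b c d = monicAW q a b d c := by
  funext m
  rcases m with n | n
  · change C _ * (C _ * _) = C _ * (C _ * _)
    rw [show a * b * d * c = a * b * c * d by ring]
    simp only [mul_right_comm _ (qPoch q (a * c) _) (qPoch q (a * d) _)]
  · rfl

/-! ### Divided differences -/

/-- Take z = x + w with w² = x² - 1; its inverse is x - w. -/
theorem exists_lattice_eq (x : ℂ) : ∃ z : ℂ, z ≠ 0 ∧ lattice z = x := by
  obtain ⟨w, hw⟩ := IsAlgClosed.exists_pow_nat_eq (x ^ 2 - 1) (n := 2) (by norm_num)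
  have h : (x + w) * (x - w) = 1 := by linear_combination -hw
  refine ⟨x + w, left_ne_zero_of_mul_eq_one h, ?_⟩
  rw [lattice, inv_eq_of_mul_eq_one_right h]
  ring

/-- Uniqueness behind the choice made in `awD`. The defining relation is void at z = ±1, that is at
x = ±1, so both polynomials are first multiplied by X² - 1, which is ((z - z⁻¹)/2)² at `lattice z`,
and this nonzero factor is then cancelled. -/
theorem awD_eq {r : ℂ} (hr0 : r ≠ 0) (hr : r ^ 2 ≠ 1) {f g : ℂ[X]}
    (h : ∀ z : ℂ, z ≠ 0 → g.eval (lattice z) * ((z - z⁻¹) * (r - r⁻¹) / 2) =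
      f.eval (lattice (r * z)) - f.eval (lattice (r⁻¹ * z))) : awD r f = g := by
  have aux : (X ^ 2 - 1 : ℂ[X]) * (awD r f) = (X ^ 2 - 1) * g := by
    refine Polynomial.funext fun x => ?_
    obtain ⟨z, hz, rfl⟩ := exists_lattice_eq x
    have h1 := (Classical.choose_spec (exists_dividedDifference r f) z hz).trans (h z hz).symm
    have hr' : r - r⁻¹ ≠ 0 := fun e => hr (by
      rw [sub_eq_zero] at e; rw [sq]; nth_rewrite 1 [e]; exact inv_mul_cancel₀ hr0)
    have h2 : (awD r f).eval (lattice z) * (z - z⁻¹) = g.eval (lattice z) * (z - z⁻¹) := by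
      apply mul_right_cancel₀ hr'
      change (awD r f).eval (lattice z) * _ = _ at h1
      linear_combination 2 * h1
    have h3 : lattice z ^ 2 - 1 = (z - z⁻¹) * ((z - z⁻¹) / 4) := by
      rw [lattice]; field_simp; ring
    simp only [eval_mul, eval_sub, eval_pow, eval_X, eval_one, h3]
    linear_combination (z - z⁻¹) / 4 * h2
  refine mul_left_cancel₀ (fun e => ?_) aux
  have := congrArg (eval 0) e
  simp at this

theorem awD_spec (r : ℂ) (f : ℂ[X]) {z : ℂ} (hz : z ≠ 0) :
    (awD r f).eval (lattice z) * ((z - z⁻¹) * (r - r⁻¹) / 2) =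
      f.eval (lattice (r * z)) - f.eval (lattice (r⁻¹ * z)) :=
  Classical.choose_spec (exists_dividedDifference r f) z hz

theorem awD_C_mul {r : ℂ} (hr0 : r ≠ 0) (hr : r ^ 2 ≠ 1) (s : ℂ) (f : ℂ[X]) :
    awD r (C s * f) = C s * awD r f := by
  refine awD_eq hr0 hr fun z hz => ?_
  simp only [eval_mul, eval_C]
  linear_combination s * awD_spec r f hz

theorem awD_sum {r : ℂ} (hr0 : r ≠ 0) (hr : r ^ 2 ≠ 1) {ι : Type*} (s : Finset ι)
    (f : ι → ℂ[X]) : awD r (∑ i ∈ s, f i) = ∑ i ∈ s, awD r (f i) := by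
  refine awD_eq hr0 hr fun z hz => ?_
  simp only [eval_finsetSum, Finset.sum_mul, ← Finset.sum_sub_distrib]
  exact Finset.sum_congr rfl fun i _ => awD_spec r (f i) hz

theorem awD_zero {r : ℂ} (hr0 : r ≠ 0) (hr : r ^ 2 ≠ 1) : awD r 0 = 0 :=
  awD_eq hr0 hr fun z _ => by simp

theorem awD_one {r : ℂ} (hr0 : r ≠ 0) (hr : r ^ 2 ≠ 1) : awD r 1 = 0 :=
  awD_eq hr0 hr fun z _ => by simp

/-- At rz and r⁻¹z the products share the factor (arz⁻¹, arz; q)_k. Only one end factor of each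
remains to be subtracted, and the difference is a multiple of z - z⁻¹. -/
theorem awD_basisPoly_succ {r : ℂ} (hr0 : r ≠ 0) (hr : r ^ 2 ≠ 1) (a : ℂ) (k : ℕ) :
    awD r (basisPoly (r ^ 2) a (k + 1)) =
      C (-2 * a * (1 - (r ^ 2) ^ (k + 1)) / (1 - r ^ 2)) * basisPoly (r ^ 2) (a * r) k := by
  refine awD_eq hr0 hr fun z hz => ?_
  have hrz : r * z ≠ 0 := mul_ne_zero hr0 hz
  have hrz' : r⁻¹ * z ≠ 0 := mul_ne_zero (inv_ne_zero hr0) hz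
  rw [eval_mul, eval_C, eval_basisPoly _ _ _ hz, eval_basisPoly _ _ _ hrz,
    eval_basisPoly _ _ _ hrz']
  have e1 : a * r * z⁻¹ = a * (r * z)⁻¹ * r ^ 2 := by field_simp
  have e2 : a * (r⁻¹ * z)⁻¹ = a * r * z⁻¹ := by field_simp
  have e3 : a * (r * z) = a * r * z := by ring
  have e4 : a * r * z = a * (r⁻¹ * z) * r ^ 2 := by field_simp
  rw [e2, e3, qPoch_succ' _ (a * (r * z)⁻¹), ← e1, qPoch_succ _ (a * r * z),
    qPoch_succ' _ (a * (r⁻¹ * z)), ← e4, qPoch_succ _ (a * r * z⁻¹)]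
  have h1 : 1 - r ^ 2 ≠ 0 := sub_ne_zero.2 hr.symm
  generalize qPoch (r ^ 2) (a * r * z⁻¹) k = u
  generalize qPoch (r ^ 2) (a * r * z) k = v
  rw [pow_succ]
  generalize (r ^ 2) ^ k = w
  field_simp
  ring

theorem basisPoly_succ' (q a : ℂ) (k : ℕ) :
    basisPoly q a (k + 1) = (1 - C (2 * a) * X + C (a ^ 2)) * basisPoly q (a * q) k := by
  rw [basisPoly, Finset.prod_range_succ', mul_comm, basisPoly]
  congr 1
  · simp
  · refine Finset.prod_congr rfl fun j _ => ?_
    rw [show 2 * a * q ^ (j + 1) = 2 * (a * q) * q ^ j by ring,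
      show a ^ 2 * q ^ (2 * (j + 1)) = (a * q) ^ 2 * q ^ (2 * j) by ring]

/-- Both products of k + 1 factors contain `basisPoly q (a * q) k`. The remaining factors, the first
of one and the last of the other, are linear in X, so one is a multiple of the other plus a
constant. -/
theorem basisPoly_shift {q : ℂ} (hq0 : q ≠ 0) (a : ℂ) (k : ℕ) :
    basisPoly q a (k + 1) = C ((q ^ (k + 1))⁻¹) * basisPoly q (a * q) (k + 1) -
      C ((q ^ (k + 1))⁻¹ * (1 - q ^ (k + 1)) * (1 - a ^ 2 * q ^ (k + 1))) *
        basisPoly q (a * q) k := by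
  have h : basisPoly q (a * q) (k + 1) = basisPoly q (a * q) k *
      (1 - C (2 * (a * q) * q ^ k) * X + C ((a * q) ^ 2 * q ^ (2 * k))) :=
    Finset.prod_range_succ _ _
  rw [basisPoly_succ', h]
  refine Polynomial.funext fun x => ?_
  have hk : q ^ k ≠ 0 := pow_ne_zero _ hq0
  simp only [eval_mul, eval_sub, eval_add, eval_one, eval_C, eval_X]
  rw [show q ^ (2 * k) = (q ^ k) ^ 2 by ring, pow_succ q k]
  generalize q ^ k = w at hk ⊢
  field_simp
  ring

theorem qPoch_mul_eq_div {q x : ℂ} (h : 1 - x ≠ 0) (k : ℕ) :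
    qPoch q (x * q) k = qPoch q x k * (1 - x * q ^ k) / (1 - x) := by
  rw [eq_div_iff h, mul_comm, qPoch_shift]

/-- This direction divides by q^{n+1} - 1, which is never zero; solving for the other factorial
would divide by zero at k = n + 1. -/
theorem qPoch_neg_eq {q : ℂ} (hq0 : q ≠ 0) (hq : ∀ k : ℕ, 1 ≤ k → q ^ k ≠ 1) (n k : ℕ) :
    qPoch q (q ^ (-(n : ℤ))) k =
      qPoch q (q ^ (-((n + 1 : ℕ) : ℤ))) k * (q ^ n * q - q ^ k) / (q ^ n * q - 1) := by
  have h1 : q ^ n * q - 1 ≠ 0 := by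
    rw [← pow_succ]; exact sub_ne_zero.2 (hq _ (by omega))
  have e : q ^ (-((n + 1 : ℕ) : ℤ)) = (q ^ n * q)⁻¹ := by
    rw [zpow_neg, zpow_natCast, pow_succ]
  have e' : q ^ (-(n : ℤ)) = (q ^ n * q)⁻¹ * q := by
    rw [zpow_neg, zpow_natCast]; field_simp
  have := qPoch_shift q ((q ^ n * q)⁻¹) k
  rw [e, e', eq_div_iff h1]
  have hn : q ^ n ≠ 0 := pow_ne_zero _ hq0
  field_simp at this ⊢
  linear_combination this

/-! ### Stability of the parameter conditions under shifts and permutations. -/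

namespace Admissible

variable {q a b c d : ℂ}

theorem qPoch_abcd_ne_zero (h : Admissible q a b c d) (n k : ℕ) :
    qPoch q (a * b * c * d * q ^ n) k ≠ 0 :=
  qPoch_ne_zero (fun j => by rw [mul_assoc, ← pow_add]; exact h.abcd _) k

theorem one_sub_ab (h : Admissible q a b c d) (k : ℕ) : 1 - a * b * q ^ k ≠ 0 :=
  sub_ne_zero.2 (h.ab k).symm

theorem one_sub_ac (h : Admissible q a b c d) (k : ℕ) : 1 - a * c * q ^ k ≠ 0 :=
  sub_ne_zero.2 (h.ac k).symm

theorem one_sub_ad (h : Admissible q a b c d) (k : ℕ) : 1 - a * d * q ^ k ≠ 0 :=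
  sub_ne_zero.2 (h.ad k).symm

theorem one_sub_abcd (h : Admissible q a b c d) (k : ℕ) : 1 - a * b * c * d * q ^ k ≠ 0 :=
  sub_ne_zero.2 (h.abcd k).symm

theorem swap_bc (h : Admissible q a b c d) : Admissible q a c b d :=
  ⟨h.ne_zero, h.ac, h.ab, h.ad, fun k => by
    rw [show a * c * b * d = a * b * c * d by ring]; exact h.abcd k⟩

theorem swap_cd (h : Admissible q a b c d) : Admissible q a b d c :=
  ⟨h.ne_zero, h.ab, h.ad, h.ac, fun k => by
    rw [show a * b * d * c = a * b * c * d by ring]; exact h.abcd k⟩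

theorem shift_b (h : Admissible q a b c d) : Admissible q a (b * q) c d :=
  ⟨h.ne_zero, fun k => by
    rw [show a * (b * q) * q ^ k = a * b * q ^ (k + 1) by ring]; exact h.ab _, h.ac, h.ad,
    fun k => by
    rw [show a * (b * q) * c * d * q ^ k = a * b * c * d * q ^ (k + 1) by ring]; exact h.abcd _⟩

theorem shift_a (hq0 : q ≠ 0) (h : Admissible q a b c d) : Admissible q (a * q) b c d :=
  ⟨mul_ne_zero h.ne_zero hq0, fun k => by
    rw [show a * q * b * q ^ k = a * b * q ^ (k + 1) by ring]; exact h.ab _, fun k => by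
    rw [show a * q * c * q ^ k = a * c * q ^ (k + 1) by ring]; exact h.ac _, fun k => by
    rw [show a * q * d * q ^ k = a * d * q ^ (k + 1) by ring]; exact h.ad _, fun k => by
    rw [show a * q * b * c * d * q ^ k = a * b * c * d * q ^ (k + 1) by ring]; exact h.abcd _⟩

theorem shift_half {r : ℂ} (hr0 : r ≠ 0) (h : Admissible (r ^ 2) a b c d) :
    Admissible (r ^ 2) (a * r) (b * r) (c * r) (d * r) :=
  ⟨mul_ne_zero h.ne_zero hr0, fun k => by
    rw [show a * r * (b * r) * (r ^ 2) ^ k = a * b * (r ^ 2) ^ (k + 1) by ring]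
    exact h.ab _, fun k => by
    rw [show a * r * (c * r) * (r ^ 2) ^ k = a * c * (r ^ 2) ^ (k + 1) by ring]
    exact h.ac _, fun k => by
    rw [show a * r * (d * r) * (r ^ 2) ^ k = a * d * (r ^ 2) ^ (k + 1) by ring]
    exact h.ad _, fun k => by
    rw [show a * r * (b * r) * (c * r) * (d * r) * (r ^ 2) ^ k =
      a * b * c * d * (r ^ 2) ^ (k + 2) by ring]
    exact h.abcd _⟩

end Admissible

/-! ### Contiguous relations for the coefficients. -/

theorem monicCoeff_succ (q a b c d : ℂ) (n k : ℕ) :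
    monicCoeff q a b c d (n + 1) k =
      (2 ^ (n + 1) * qPoch q (a * b * c * d * q ^ n) (n + 1))⁻¹ *
        (qPoch q (a * b) (n + 1) * qPoch q (a * c) (n + 1) * qPoch q (a * d) (n + 1) /
          a ^ (n + 1)) *
        (qPoch q (q ^ (-((n + 1 : ℕ) : ℤ))) k * qPoch q (a * b * c * d * q ^ n) k /
          (qPoch q (a * b) k * qPoch q (a * c) k * qPoch q (a * d) k) *
          (q ^ k / qPoch q q k)) := by
  rw [monicCoeff, show ((n + 1 : ℕ) : ℤ) - 1 = (n : ℤ) by push_cast; ring, zpow_natCast]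

theorem coeffC_succ (q a b c d : ℂ) (n : ℕ) :
    coeffC q ((n + 1 : ℕ) : ℤ) a b c d =
      a * (1 - q ^ n * q) * (1 - b * c * q ^ n) * (1 - b * d * q ^ n) * (1 - d * c * q ^ n) /
        ((1 - a * b * c * d * q ^ n * q ^ n) * (1 - a * b * c * d * q ^ n * q ^ n * q)) := by
  rw [coeffC, show ((n + 1 : ℕ) : ℤ) - 1 = (n : ℤ) by push_cast; ring,
    show 2 * ((n + 1 : ℕ) : ℤ) - 2 = ((2 * n : ℕ) : ℤ) by push_cast; ring,
    show 2 * ((n + 1 : ℕ) : ℤ) - 1 = ((2 * n + 1 : ℕ) : ℤ) by push_cast; ring]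
  simp only [zpow_natCast]
  rw [show q ^ (2 * n) = q ^ n * q ^ n by ring, show q ^ (2 * n + 1) = q ^ n * q ^ n * q by ring,
    pow_succ]
  simp only [mul_assoc]

/-- Once every factorial is reduced to the unshifted ones, these cancel and a rational identity in
q^n and q^k remains. -/
theorem monicCoeff_shift_b {q a b c d : ℂ} (hq0 : q ≠ 0) (hq : ∀ k : ℕ, 1 ≤ k → q ^ k ≠ 1)
    (h : Admissible q a b c d) (n k : ℕ) :
    monicCoeff q a b c d (n + 1) k = monicCoeff q a (b * q) c d (n + 1) k -
      1 / 2 * coeffC q ((n + 1 : ℕ) : ℤ) b a c d * monicCoeff q a (b * q) c d n k := by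
  have ha := h.ne_zero
  have hs : a * (b * q) * c * d * q ^ ((n : ℤ) - 1) = a * b * c * d * q ^ n := by
    rw [zpow_sub₀ hq0, zpow_natCast, zpow_one]; field_simp
  have h1 : 1 - a * b ≠ 0 := by simpa using h.one_sub_ab 0
  have hK := h.one_sub_ab k
  have hN := h.one_sub_ab n
  have hs0 := h.one_sub_abcd n
  have hsK : 1 - a * b * c * d * q ^ n * q ^ k ≠ 0 := by
    simpa only [mul_assoc, ← pow_add] using h.one_sub_abcd (n + k)
  have hsN : 1 - a * b * c * d * q ^ n * q ^ n ≠ 0 := by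
    simpa only [mul_assoc, ← pow_add] using h.one_sub_abcd (n + n)
  have hsN' : 1 - a * b * c * d * q ^ n * q ^ n * q ≠ 0 := by
    simpa only [mul_assoc, ← pow_add, ← pow_succ] using h.one_sub_abcd (n + n + 1)
  have hQ : q ^ n * q - 1 ≠ 0 := by
    rw [← pow_succ]; exact sub_ne_zero.2 (hq _ (by omega))
  have hqq : qPoch q q k ≠ 0 := qPoch_ne_zero (fun k => by
    rw [← pow_succ']; exact hq _ (by omega)) k
  have pAn := qPoch_ne_zero h.ab n
  have pBn := qPoch_ne_zero h.ac n
  have pDn := qPoch_ne_zero h.ad n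
  have pAk := qPoch_ne_zero h.ab k
  have pBk := qPoch_ne_zero h.ac k
  have pDk := qPoch_ne_zero h.ad k
  have pSn := h.qPoch_abcd_ne_zero n n
  have pSk := h.qPoch_abcd_ne_zero n k
  rw [monicCoeff_succ, monicCoeff_succ, monicCoeff, hs, coeffC_succ,
    show a * (b * q) = a * b * q by ring, show a * b * q * c * d * q ^ n =
      a * b * c * d * q ^ n * q by ring, show b * a * c * d = a * b * c * d by ring]
  simp only [qPoch_succ, qPoch_mul_eq_div h1, qPoch_mul_eq_div hs0, qPoch_neg_eq hq0 hq n k]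
  generalize qPoch q (q ^ (-((n + 1 : ℕ) : ℤ))) k = U
  simp only [pow_succ]
  have hQ0 : q ^ n ≠ 0 := pow_ne_zero _ hq0
  have hK0 : q ^ k ≠ 0 := pow_ne_zero _ hq0
  generalize qPoch q (a * b) n = An at *
  generalize qPoch q (a * c) n = Bn at *
  generalize qPoch q (a * d) n = Dn at *
  generalize qPoch q (a * b) k = Ak at *
  generalize qPoch q (a * c) k = Bk at *
  generalize qPoch q (a * d) k = Dk at *
  generalize qPoch q (a * b * c * d * q ^ n) n = Sn at *
  generalize qPoch q (a * b * c * d * q ^ n) k = Sk at *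
  generalize q ^ n = Q at *
  generalize q ^ k = K at *
  generalize qPoch q q k = T at *
  -- The product abcd q^n is kept as one atom while denominators are cleared, and expanded only for
  -- the final polynomial identity.
  generalize hs' : a * b * c * d * Q = s at *
  field_simp
  rw [← hs']
  ring

/-- The left side is the coefficient of `basisPoly q (a * q) k` after each basis element of P_{n+1}
is rewritten by `basisPoly_shift`. -/
theorem monicCoeff_shift_a {q a b c d : ℂ} (hq0 : q ≠ 0) (hq : ∀ k : ℕ, 1 ≤ k → q ^ k ≠ 1)
    (h : Admissible q a b c d) (n k : ℕ) :
    monicCoeff q a b c d (n + 1) k * (q ^ k)⁻¹ -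
        monicCoeff q a b c d (n + 1) (k + 1) *
          ((q ^ (k + 1))⁻¹ * (1 - q ^ (k + 1)) * (1 - a ^ 2 * q ^ (k + 1))) =
      monicCoeff q (a * q) b c d (n + 1) k -
        1 / 2 * coeffC q ((n + 1 : ℕ) : ℤ) a b c d * monicCoeff q (a * q) b c d n k := by
  have ha := h.ne_zero
  have hs : a * q * b * c * d * q ^ ((n : ℤ) - 1) = a * b * c * d * q ^ n := by
    rw [zpow_sub₀ hq0, zpow_natCast, zpow_one]; field_simp
  have h1 : 1 - a * b ≠ 0 := by simpa using h.one_sub_ab 0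
  have h2 : 1 - a * c ≠ 0 := by simpa using h.one_sub_ac 0
  have h3 : 1 - a * d ≠ 0 := by simpa using h.one_sub_ad 0
  have hK1 := h.one_sub_ab k
  have hN1 := h.one_sub_ab n
  have hK2 := h.one_sub_ac k
  have hN2 := h.one_sub_ac n
  have hK3 := h.one_sub_ad k
  have hN3 := h.one_sub_ad n
  have hs0 := h.one_sub_abcd n
  have hsK : 1 - a * b * c * d * q ^ n * q ^ k ≠ 0 := by
    simpa only [mul_assoc, ← pow_add] using h.one_sub_abcd (n + k)
  have hsN : 1 - a * b * c * d * q ^ n * q ^ n ≠ 0 := by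
    simpa only [mul_assoc, ← pow_add] using h.one_sub_abcd (n + n)
  have hsN' : 1 - a * b * c * d * q ^ n * q ^ n * q ≠ 0 := by
    simpa only [mul_assoc, ← pow_add, ← pow_succ] using h.one_sub_abcd (n + n + 1)
  have hQ : q ^ n * q - 1 ≠ 0 := by
    rw [← pow_succ]; exact sub_ne_zero.2 (hq _ (by omega))
  have hqk : 1 - q * q ^ k ≠ 0 := by
    rw [← pow_succ']; exact sub_ne_zero.2 (hq _ (by omega)).symm
  rw [mul_comm q] at hqk
  have hqq : qPoch q q k ≠ 0 := qPoch_ne_zero (fun k => by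
    rw [← pow_succ']; exact hq _ (by omega)) k
  have pAn := qPoch_ne_zero h.ab n
  have pBn := qPoch_ne_zero h.ac n
  have pDn := qPoch_ne_zero h.ad n
  have pAk := qPoch_ne_zero h.ab k
  have pBk := qPoch_ne_zero h.ac k
  have pDk := qPoch_ne_zero h.ad k
  have pSn := h.qPoch_abcd_ne_zero n n
  have pSk := h.qPoch_abcd_ne_zero n k
  have e : q ^ (-((n + 1 : ℕ) : ℤ)) = (q ^ n * q)⁻¹ := by
    rw [zpow_neg, zpow_natCast, pow_succ]
  rw [monicCoeff_succ, monicCoeff_succ, monicCoeff_succ, monicCoeff, hs, coeffC_succ,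
    show a * q * b = a * b * q by ring, show a * q * c = a * c * q by ring,
    show a * q * d = a * d * q by ring, show a * b * q * c * d * q ^ n =
      a * b * c * d * q ^ n * q by ring]
  simp only [qPoch_neg_eq hq0 hq n k]
  simp only [qPoch_succ, qPoch_mul_eq_div h1, qPoch_mul_eq_div h2, qPoch_mul_eq_div h3,
    qPoch_mul_eq_div hs0]
  generalize qPoch q (q ^ (-((n + 1 : ℕ) : ℤ))) k = U
  rw [e]
  simp only [pow_succ _ n, pow_succ _ k, mul_pow]
  have hQ0 : q ^ n ≠ 0 := pow_ne_zero _ hq0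
  have hK0 : q ^ k ≠ 0 := pow_ne_zero _ hq0
  generalize qPoch q (a * b) n = An at *
  generalize qPoch q (a * c) n = Bn at *
  generalize qPoch q (a * d) n = Dn at *
  generalize qPoch q (a * b) k = Ak at *
  generalize qPoch q (a * c) k = Bk at *
  generalize qPoch q (a * d) k = Dk at *
  generalize qPoch q (a * b * c * d * q ^ n) n = Sn at *
  generalize qPoch q (a * b * c * d * q ^ n) k = Sk at *
  generalize q ^ n = Q at *
  generalize q ^ k = K at *
  generalize qPoch q q k = T at *
  rw [show a * b * q * Q = a * b * (Q * q) by ring, show a * c * q * Q = a * c * (Q * q) by ring,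
    show a * d * q * Q = a * d * (Q * q) by ring,
    show a * b * c * d * Q * q * Q = a * b * c * d * Q * Q * q by ring, mul_comm q K]
  -- The whole content of the lemma: the relation with the common factor removed and denominators
  -- cleared. Afterwards the linear factors can be treated as independent atoms.
  have key : Q * q * (1 - a * b * c * d * Q * Q * q) *
        ((1 - a * b * K) * (1 - a * c * K) * (1 - a * d * K)) -
      (Q * q - K) * (1 - a * b * c * d * Q * K) * (1 - a ^ 2 * (K * q)) *
        (1 - a * b * c * d * Q * Q * q) =
      K * (1 - a * b * c * d * Q * K) *
        ((1 - a * b * (Q * q)) * (1 - a * c * (Q * q)) * (1 - a * d * (Q * q))) +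
      a ^ 2 * K * q * (Q * q - K) *
        ((1 - b * c * Q) * (1 - b * d * Q) * (1 - d * c * Q)) := by ring
  generalize a * b * c * d * Q = s at *
  generalize 1 - s * Q = sQ at *
  generalize 1 - s * Q * q = sQ' at *
  generalize 1 - s * K = sK at *
  generalize 1 - s = s1 at *
  generalize 1 - a * b * (Q * q) = A' at *
  generalize 1 - a * c * (Q * q) = B' at *
  generalize 1 - a * d * (Q * q) = D' at *
  generalize 1 - a * b * Q = A at *
  generalize 1 - a * c * Q = B at *
  generalize 1 - a * d * Q = D at *
  generalize 1 - a * b * K = AK at *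
  generalize 1 - a * c * K = BK at *
  generalize 1 - a * d * K = DK at *
  generalize 1 - a * b = A1 at *
  generalize 1 - a * c = B1 at *
  generalize 1 - a * d = D1 at *
  generalize 1 - K * q = κ at *
  generalize 1 - a ^ 2 * (K * q) = h at *
  generalize 1 - b * c * Q = g1 at *
  generalize 1 - b * d * Q = g2 at *
  generalize 1 - d * c * Q = g3 at *
  have small : A * B * D / (2 * a * sQ) -
      A * B * D / (2 * a * sQ) * (1 - K / (Q * q)) * sK * h / (AK * BK * DK) =
      A * B * D / (2 * a * sQ) * (K * sK * (A' * B' * D') / (Q * q * sQ' * (AK * BK * DK))) -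
      1 / 2 * (a * (1 - Q * q) * g1 * g2 * g3 / (sQ * sQ')) *
        (K / Q * (A * B * D) * (Q * q - K) / ((Q * q - 1) * (AK * BK * DK))) := by
    have hP : AK * BK * DK ≠ 0 := mul_ne_zero (mul_ne_zero hK1 hK2) hK3
    generalize AK * BK * DK = P at *
    generalize A' * B' * D' = P' at *
    field_simp
    linear_combination (Q * q - 1) * key
  calc _ = An * Bn * Dn * U * Sk / (2 ^ n * a ^ n * Sn * Ak * Bk * Dk * T) *
        (A * B * D / (2 * a * sQ) -
          A * B * D / (2 * a * sQ) * (1 - K / (Q * q)) * sK * h / (AK * BK * DK)) := by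
        rw [mul_sub]; field_simp
    _ = _ := by
        rw [small, mul_sub]; congr 1 <;> field_simp

theorem gammaAW_natCast_succ (r : ℂ) (n : ℕ) :
    gammaAW r ((n + 1 : ℕ) : ℤ) = (r ^ n * r - (r ^ n * r)⁻¹) / (r - r⁻¹) := by
  rw [gammaAW, zpow_neg, zpow_natCast, pow_succ]

/-- The constant on the left is the one from `awD_basisPoly_succ`. Each (x; q)_{k+1} equals (1 -
x)(xq; q)_k, which turns unshifted parameter products into shifted ones. -/
theorem monicCoeff_awD {r a b c d : ℂ} (hr0 : r ≠ 0)
    (hq : ∀ k : ℕ, 1 ≤ k → (r ^ 2) ^ k ≠ 1) (h : Admissible (r ^ 2) a b c d) (n k : ℕ) :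
    monicCoeff (r ^ 2) a b c d (n + 1) (k + 1) *
        (-2 * a * (1 - (r ^ 2) ^ (k + 1)) / (1 - r ^ 2)) =
      gammaAW r ((n + 1 : ℕ) : ℤ) *
        monicCoeff (r ^ 2) (a * r) (b * r) (c * r) (d * r) n k := by
  have ha := h.ne_zero
  have hs : a * r * (b * r) * (c * r) * (d * r) * (r ^ 2) ^ ((n : ℤ) - 1) =
      a * b * c * d * (r ^ 2) ^ n * r ^ 2 := by
    rw [zpow_sub₀ (pow_ne_zero 2 hr0), zpow_natCast, zpow_one]; field_simp
  have h1 : 1 - a * b ≠ 0 := by simpa using h.one_sub_ab 0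
  have h2 : 1 - a * c ≠ 0 := by simpa using h.one_sub_ac 0
  have h3 : 1 - a * d ≠ 0 := by simpa using h.one_sub_ad 0
  have hs0 := h.one_sub_abcd n
  have hqk : 1 - r ^ 2 * (r ^ 2) ^ k ≠ 0 := by
    rw [← pow_succ']; exact sub_ne_zero.2 (hq _ (by omega)).symm
  have hqq : qPoch (r ^ 2) (r ^ 2) k ≠ 0 := qPoch_ne_zero (fun k => by
    rw [← pow_succ']; exact hq _ (by omega)) k
  have hr1 : 1 - r ^ 2 ≠ 0 := by simpa using sub_ne_zero.2 (hq 1 le_rfl).symm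
  have hr1' : r ^ 2 - 1 ≠ 0 := by simpa using sub_ne_zero.2 (hq 1 le_rfl)
  have sh := h.shift_half hr0
  have pAn := qPoch_ne_zero sh.ab n
  have pBn := qPoch_ne_zero sh.ac n
  have pDn := qPoch_ne_zero sh.ad n
  have pAk := qPoch_ne_zero sh.ab k
  have pBk := qPoch_ne_zero sh.ac k
  have pDk := qPoch_ne_zero sh.ad k
  have pSn : qPoch (r ^ 2) (a * b * c * d * (r ^ 2) ^ n * r ^ 2) n ≠ 0 := by
    rw [mul_assoc _ ((r ^ 2) ^ n), ← pow_succ]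
    exact h.qPoch_abcd_ne_zero _ _
  have pSk : qPoch (r ^ 2) (a * b * c * d * (r ^ 2) ^ n * r ^ 2) k ≠ 0 := by
    rw [mul_assoc _ ((r ^ 2) ^ n), ← pow_succ]
    exact h.qPoch_abcd_ne_zero _ _
  have e : (r ^ 2) ^ (-((n + 1 : ℕ) : ℤ)) = ((r ^ 2) ^ n * r ^ 2)⁻¹ := by
    rw [zpow_neg, zpow_natCast, pow_succ]
  have e' : ((r ^ 2) ^ n * r ^ 2)⁻¹ * r ^ 2 = (r ^ 2) ^ (-(n : ℤ)) := by
    rw [zpow_neg, zpow_natCast]; field_simp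
  rw [show a * r * (b * r) = a * b * r ^ 2 by ring] at pAn pAk
  rw [show a * r * (c * r) = a * c * r ^ 2 by ring] at pBn pBk
  rw [show a * r * (d * r) = a * d * r ^ 2 by ring] at pDn pDk
  rw [monicCoeff_succ, monicCoeff, hs, gammaAW_natCast_succ,
    show a * r * (b * r) = a * b * r ^ 2 by ring,
    show a * r * (c * r) = a * c * r ^ 2 by ring,
    show a * r * (d * r) = a * d * r ^ 2 by ring, qPoch_succ (r ^ 2) (r ^ 2)]
  simp only [qPoch_succ', e, e', mul_pow, pow_succ _ n, pow_succ _ k]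
  generalize qPoch (r ^ 2) ((r ^ 2) ^ (-(n : ℤ))) k = U
  -- γ_{n+1} involves r^n, so q^n is written through the same quantity.
  rw [show (r ^ 2) ^ n = r ^ n * r ^ n by ring] at *
  have hQ0 : r ^ n ≠ 0 := pow_ne_zero _ hr0
  have hK0 : (r ^ 2) ^ k ≠ 0 := pow_ne_zero _ (pow_ne_zero _ hr0)
  generalize qPoch (r ^ 2) (a * b * r ^ 2) n = An at *
  generalize qPoch (r ^ 2) (a * c * r ^ 2) n = Bn at *
  generalize qPoch (r ^ 2) (a * d * r ^ 2) n = Dn at *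
  generalize qPoch (r ^ 2) (a * b * r ^ 2) k = Ak at *
  generalize qPoch (r ^ 2) (a * c * r ^ 2) k = Bk at *
  generalize qPoch (r ^ 2) (a * d * r ^ 2) k = Dk at *
  generalize qPoch (r ^ 2) (a * b * c * d * (r ^ n * r ^ n) * r ^ 2) n = Sn at *
  generalize qPoch (r ^ 2) (a * b * c * d * (r ^ n * r ^ n) * r ^ 2) k = Sk at *
  generalize r ^ n = Q at *
  generalize (r ^ 2) ^ k = K at *
  generalize qPoch (r ^ 2) (r ^ 2) k = T at *
  generalize hs' : a * b * c * d * (Q * Q) = s at *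
  field_simp
  ring

/-! ### Relations between the polynomials themselves. -/

theorem coeffC_zero (q a b c d : ℂ) : coeffC q 0 a b c d = 0 := by simp [coeffC]

/-- Allowing every integer m lets the shifts be iterated with no case distinction on the degree: for
m < 0 all terms vanish, and for m = 0 the factor C_0 does. -/
theorem monicAW_shift_b {q a b c d : ℂ} (hq0 : q ≠ 0) (hq : ∀ k : ℕ, 1 ≤ k → q ^ k ≠ 1)
    (h : Admissible q a b c d) (m : ℤ) :
    monicAW q a b c d m = monicAW q a (b * q) c d m -
      C (1 / 2 * coeffC q m b a c d) * monicAW q a (b * q) c d (m - 1) := by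
  rcases lt_trichotomy m 0 with hm | rfl | hm
  · simp [monicAW_neg _ _ _ _ _ hm, monicAW_neg _ _ _ _ _ (show m - 1 < 0 by omega)]
  · simp [monicAW_zero, coeffC_zero]
  · obtain ⟨n, rfl⟩ : ∃ n : ℕ, m = ((n + 1 : ℕ) : ℤ) := ⟨(m - 1).toNat, by omega⟩
    rw [show ((n + 1 : ℕ) : ℤ) - 1 = (n : ℤ) by push_cast; ring,
      monicAW_eq_sum hq0 a b c d (Nat.lt_succ_self (n + 1)),
      monicAW_eq_sum hq0 a (b * q) c d (Nat.lt_succ_self (n + 1)),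
      monicAW_eq_sum hq0 a (b * q) c d (show n < (n + 1).succ by omega), Finset.mul_sum,
      ← Finset.sum_sub_distrib]
    refine Finset.sum_congr rfl fun k _ => ?_
    rw [monicCoeff_shift_b hq0 hq h, C_sub, C_mul]
    ring

theorem monicAW_shift_a {q a b c d : ℂ} (hq0 : q ≠ 0) (hq : ∀ k : ℕ, 1 ≤ k → q ^ k ≠ 1)
    (h : Admissible q a b c d) (m : ℤ) :
    monicAW q a b c d m = monicAW q (a * q) b c d m -
      C (1 / 2 * coeffC q m a b c d) * monicAW q (a * q) b c d (m - 1) := by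
  rcases lt_trichotomy m 0 with hm | rfl | hm
  · simp [monicAW_neg _ _ _ _ _ hm, monicAW_neg _ _ _ _ _ (show m - 1 < 0 by omega)]
  · simp [monicAW_zero, coeffC_zero]
  · obtain ⟨n, rfl⟩ : ∃ n : ℕ, m = ((n + 1 : ℕ) : ℤ) := ⟨(m - 1).toNat, by omega⟩
    -- The change of basis sends contributions from k and k + 1 to index k. At k = n + 1 the second
    -- one is zero, and the constant basis element is the same for a and aq.
    have expand : monicAW q a b c d ((n + 1 : ℕ) : ℤ) = ∑ k ∈ Finset.range (n + 2),
        C (monicCoeff q a b c d (n + 1) k * (q ^ k)⁻¹ -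
          monicCoeff q a b c d (n + 1) (k + 1) *
            ((q ^ (k + 1))⁻¹ * (1 - q ^ (k + 1)) * (1 - a ^ 2 * q ^ (k + 1)))) *
          basisPoly q (a * q) k := by
      have split : ∀ k, C (monicCoeff q a b c d (n + 1) (k + 1)) * basisPoly q a (k + 1) =
          C (monicCoeff q a b c d (n + 1) (k + 1) * (q ^ (k + 1))⁻¹) *
              basisPoly q (a * q) (k + 1) -
            C (monicCoeff q a b c d (n + 1) (k + 1) *
              ((q ^ (k + 1))⁻¹ * (1 - q ^ (k + 1)) * (1 - a ^ 2 * q ^ (k + 1)))) *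
              basisPoly q (a * q) k := fun k => by
        rw [basisPoly_shift hq0, mul_sub, ← mul_assoc, ← mul_assoc, ← C_mul, ← C_mul]
      simp only [C_sub, sub_mul, Finset.sum_sub_distrib]
      rw [monicAW_eq_sum hq0 a b c d (Nat.lt_succ_self (n + 1)), Finset.sum_range_succ',
        Finset.sum_range_succ' (fun k =>
          C (monicCoeff q a b c d (n + 1) k * (q ^ k)⁻¹) * basisPoly q (a * q) k),
        Finset.sum_range_succ _ (n + 1),
        monicCoeff_eq_zero hq0 a b c d (show n + 1 < n + 1 + 1 by omega)]
      simp only [split, Finset.sum_sub_distrib]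
      simp [basisPoly]
      ring
    rw [expand, show ((n + 1 : ℕ) : ℤ) - 1 = (n : ℤ) by push_cast; ring,
      monicAW_eq_sum hq0 (a * q) b c d (show n + 1 < n + 2 by omega),
      monicAW_eq_sum hq0 (a * q) b c d (show n < n + 2 by omega), Finset.mul_sum,
      ← Finset.sum_sub_distrib]
    refine Finset.sum_congr rfl fun k _ => ?_
    rw [monicCoeff_shift_a hq0 hq h, C_sub, C_mul]
    ring

theorem monicAW_shift_c {q a b c d : ℂ} (hq0 : q ≠ 0) (hq : ∀ k : ℕ, 1 ≤ k → q ^ k ≠ 1)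
    (h : Admissible q a b c d) (m : ℤ) :
    monicAW q a b c d m = monicAW q a b (c * q) d m -
      C (1 / 2 * coeffC q m c a b d) * monicAW q a b (c * q) d (m - 1) := by
  rw [monicAW_swap_bc q a b c d, monicAW_shift_b hq0 hq h.swap_bc,
    monicAW_swap_bc q a b (c * q) d]

theorem monicAW_shift_d {q a b c d : ℂ} (hq0 : q ≠ 0) (hq : ∀ k : ℕ, 1 ≤ k → q ^ k ≠ 1)
    (h : Admissible q a b c d) (m : ℤ) :
    monicAW q a b c d m = monicAW q a b c (d * q) m -
      C (1 / 2 * coeffC q m d a b c) * monicAW q a b c (d * q) (m - 1) := by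
  rw [monicAW_swap_cd q a b c d, monicAW_shift_c hq0 hq h.swap_cd,
    monicAW_swap_cd q a b c (d * q)]

theorem coeffC_rotate (q : ℂ) (m : ℤ) (a b c d : ℂ) :
    coeffC q m a b c d = coeffC q m a d b c := by
  rw [coeffC, coeffC, show a * d * b * c = a * b * c * d by ring]
  ring

/-- The Askey-Wilson operator lowers the degree and multiplies the parameters by `q^{1/2}`. -/
theorem awD_monicAW {r a b c d : ℂ} (hr0 : r ≠ 0) (hq : ∀ k : ℕ, 1 ≤ k → (r ^ 2) ^ k ≠ 1)
    (h : Admissible (r ^ 2) a b c d) (m : ℤ) :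
    awD r (monicAW (r ^ 2) a b c d m) =
      C (gammaAW r m) * monicAW (r ^ 2) (a * r) (b * r) (c * r) (d * r) (m - 1) := by
  have hr : r ^ 2 ≠ 1 := by simpa using hq 1 le_rfl
  have hq0 : r ^ 2 ≠ 0 := pow_ne_zero _ hr0
  rcases lt_trichotomy m 0 with hm | rfl | hm
  · simp [monicAW_neg _ _ _ _ _ hm, monicAW_neg _ _ _ _ _ (show m - 1 < 0 by omega),
      awD_zero hr0 hr]
  · simp [monicAW_zero, gammaAW, awD_one hr0 hr]
  · obtain ⟨n, rfl⟩ : ∃ n : ℕ, m = ((n + 1 : ℕ) : ℤ) := ⟨(m - 1).toNat, by omega⟩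
    rw [show ((n + 1 : ℕ) : ℤ) - 1 = (n : ℤ) by push_cast; ring,
      monicAW_eq_sum hq0 a b c d (Nat.lt_succ_self (n + 1)), awD_sum hr0 hr,
      monicAW_eq_sum hq0 _ _ _ _ (Nat.lt_succ_self n), Finset.sum_range_succ', Finset.mul_sum]
    have h0 : basisPoly (r ^ 2) a 0 = 1 := by simp [basisPoly]
    rw [h0, awD_C_mul hr0 hr, awD_one hr0 hr, mul_zero, add_zero]
    refine Finset.sum_congr rfl fun k _ => ?_
    rw [awD_C_mul hr0 hr, awD_basisPoly_succ hr0 hr, ← mul_assoc, ← mul_assoc, ← C_mul, ← C_mul,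
      monicCoeff_awD hr0 hq h]

theorem awD_awD_monicAW {r a b c d : ℂ} (hr0 : r ≠ 0) (hq : ∀ k : ℕ, 1 ≤ k → (r ^ 2) ^ k ≠ 1)
    (h : Admissible (r ^ 2) a b c d) (m : ℤ) :
    awD r (awD r (monicAW (r ^ 2) a b c d m)) = C (gammaAW r m * gammaAW r (m - 1)) *
      monicAW (r ^ 2) (a * r ^ 2) (b * r ^ 2) (c * r ^ 2) (d * r ^ 2) (m - 2) := by
  have hr : r ^ 2 ≠ 1 := by simpa using hq 1 le_rfl
  rw [awD_monicAW hr0 hq h, awD_C_mul hr0 hr, awD_monicAW hr0 hq (h.shift_half hr0), C_mul,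
    ← mul_assoc, show m - 1 - 1 = m - 2 by ring]
  simp only [sq, mul_assoc]

/-! ### Existence of the coefficients and comparison of the expansions. -/

theorem gammaAW_ne_zero {r : ℂ} (hr0 : r ≠ 0) (hq : ∀ k : ℕ, 1 ≤ k → (r ^ 2) ^ k ≠ 1) {m : ℤ}
    (hm : m ≠ 0) : gammaAW r m ≠ 0 := by
  have key : ∀ k : ℕ, 1 ≤ k → r ^ k - (r ^ k)⁻¹ ≠ 0 := fun k hk e => hq k hk (by
    have h0 : r ^ k ≠ 0 := pow_ne_zero _ hr0
    rw [sub_eq_zero] at e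
    rw [← pow_mul, mul_comm, pow_mul, sq]
    nth_rewrite 1 [e]
    exact inv_mul_cancel₀ h0)
  refine div_ne_zero ?_ (by simpa using key 1 le_rfl)
  obtain ⟨k, rfl | rfl⟩ := m.eq_nat_or_neg
  · rw [zpow_neg, zpow_natCast]
    exact key k (by omega)
  · rw [neg_neg, zpow_neg, zpow_natCast, ← neg_sub, neg_ne_zero]
    exact key k (by omega)

/-- An equation `s γ_m γ_{m-1} x = t` is solvable if its right-hand side vanishes
at the zeros `m = 0` and `m = 1` of the left-hand side. -/
theorem exists_gammaAW_mul_eq {r : ℂ} (hr0 : r ≠ 0) (hq : ∀ k : ℕ, 1 ≤ k → (r ^ 2) ^ k ≠ 1)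
    {s t : ℂ} (hs : s ≠ 0) {m m' : ℤ} (h : m' = m - 1) (h0 : m = 0 → t = 0)
    (h1 : m = 1 → t = 0) : ∃ x, s * gammaAW r m * gammaAW r m' * x = t := by
  by_cases hm : m = 0
  · exact ⟨0, by rw [h0 hm, mul_zero]⟩
  by_cases hm' : m = 1
  · exact ⟨0, by rw [h1 hm', mul_zero]⟩
  · exact ⟨_, mul_div_cancel₀ t (mul_ne_zero (mul_ne_zero hs (gammaAW_ne_zero hr0 hq hm))
      (gammaAW_ne_zero hr0 hq (by omega)))⟩

/-- Whenever a γ on the left vanishes, every term on the right contains C_0. In Lean `coeffC q 0` is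
0 even if its denominator vanishes, so no condition on a, b, c, d is required. -/
theorem exists_isSecondStructureCoeff {r : ℂ} (hr0 : r ≠ 0)
    (hq : ∀ k : ℕ, 1 ≤ k → (r ^ 2) ^ k ≠ 1) (a b c d : ℂ) {n : ℤ} (hn : 0 ≤ n) :
    ∃ β : ℤ → ℂ, IsSecondStructureCoeff (r ^ 2) r a b c d n β := by
  set q := r ^ 2
  obtain ⟨x2, h2⟩ : ∃ x, 1 * gammaAW r (n + 2) * gammaAW r (n + 1) * x = 1 :=
    exists_gammaAW_mul_eq hr0 hq one_ne_zero (by ring) (by omega) (by omega)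
  obtain ⟨x1, h1⟩ : ∃ x, -2 * gammaAW r (n + 1) * gammaAW r n * x =
      coeffC q n b (a * q) c d + coeffC q n a b c d + coeffC q n d (c * q) (a * q) (b * q) +
        coeffC q n c d (a * q) (b * q) := by
    refine exists_gammaAW_mul_eq hr0 hq (by norm_num) (by ring) (by omega) fun h => ?_
    obtain rfl : n = 0 := by omega
    simp [coeffC_zero]
  obtain ⟨x0, h0⟩ : ∃ x, 4 * gammaAW r n * gammaAW r (n - 1) * x =
      (coeffC q n b (a * q) c d + coeffC q n a b c d) *
          (coeffC q (n - 1) d (c * q) (a * q) (b * q) + coeffC q (n - 1) c d (a * q) (b * q)) +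
        coeffC q n c d (a * q) (b * q) * coeffC q (n - 1) d (c * q) (a * q) (b * q) +
        coeffC q n a b c d * coeffC q (n - 1) b (a * q) c d := by
    refine exists_gammaAW_mul_eq hr0 hq (by norm_num) rfl ?_ ?_ <;> rintro rfl <;>
      simp [coeffC_zero]
  obtain ⟨y1, g1⟩ : ∃ x, -8 * gammaAW r (n - 1) * gammaAW r (n - 2) * x =
      (coeffC q n b (a * q) c d + coeffC q n a b c d) * coeffC q (n - 1) c d (a * q) (b * q) *
          coeffC q (n - 2) d (c * q) (a * q) (b * q) +
        coeffC q n a b c d * coeffC q (n - 1) b (a * q) c d *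
          (coeffC q (n - 2) d (c * q) (a * q) (b * q) +
            coeffC q (n - 2) c d (a * q) (b * q)) := by
    refine exists_gammaAW_mul_eq hr0 hq (by norm_num) (by ring) (fun h => ?_) fun h => ?_
    · obtain rfl : n = 1 := by omega
      simp [coeffC_zero]
    · obtain rfl : n = 2 := by omega
      simp [coeffC_zero]
  obtain ⟨y2, g2⟩ : ∃ x, 16 * gammaAW r (n - 2) * gammaAW r (n - 3) * x =
      coeffC q n a b c d * coeffC q (n - 1) b (a * q) c d *
        coeffC q (n - 2) c d (a * q) (b * q) * coeffC q (n - 3) d (c * q) (a * q) (b * q) := by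
    refine exists_gammaAW_mul_eq hr0 hq (by norm_num) (by ring) (fun h => ?_) fun h => ?_
    · obtain rfl : n = 2 := by omega
      simp [coeffC_zero]
    · obtain rfl : n = 3 := by omega
      simp [coeffC_zero]
  -- Only the five values at n - 2, …, n + 2 matter; `y2` serves n - 2 and is the default elsewhere.
  refine ⟨fun m => if m = n + 2 then x2 else if m = n + 1 then x1 else if m = n then x0 else
    if m = n - 1 then y1 else y2, ⟨?_, ?_, ?_, ?_, ?_⟩⟩
  · simpa using h2
  · simpa using h1
  · simpa using h0
  · simpa [show n - 1 ≠ n + 2 by omega, show n - 1 ≠ n + 1 by omega] using g1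
  · simpa [show n - 2 ≠ n + 2 by omega, show n - 2 ≠ n + 1 by omega] using g2

theorem monicAW_eq_of_isSecondStructureCoeff {r a b c d : ℂ} (hr0 : r ≠ 0)
    (hq : ∀ k : ℕ, 1 ≤ k → (r ^ 2) ^ k ≠ 1) (h : Admissible (r ^ 2) a b c d) (n : ℤ)
    {β : ℤ → ℂ} (hβ : IsSecondStructureCoeff (r ^ 2) r a b c d n β) :
    monicAW (r ^ 2) a b c d n = ∑ j ∈ Finset.Icc (-2 : ℤ) 2,
      C (β (n + j)) * awD r (awD r (monicAW (r ^ 2) a b c d (n + j))) := by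
  have hq0 : r ^ 2 ≠ 0 := pow_ne_zero _ hr0
  simp only [awD_awD_monicAW hr0 hq h]
  have hIcc : Finset.Icc (-2 : ℤ) 2 = {-2, -1, 0, 1, 2} := by decide
  obtain ⟨e2, e1, e0, f1, f2⟩ := hβ
  set q := r ^ 2
  have hA := h.shift_a hq0
  have hB := hA.shift_b
  have hC := hB.swap_bc.shift_b.swap_bc
  -- The order of the shifts fixes the arguments of C: b is shifted after a, hence C(b, aq, c, d).
  -- Likewise c precedes d in `s2`, where `coeffC_rotate` puts the last three arguments in the
  -- stated order.
  have s1 : ∀ m, monicAW q a b c d m = monicAW q (a * q) (b * q) c d m -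
      C (1 / 2 * coeffC q m b (a * q) c d) * monicAW q (a * q) (b * q) c d (m - 1) -
      C (1 / 2 * coeffC q m a b c d) * (monicAW q (a * q) (b * q) c d (m - 1) -
        C (1 / 2 * coeffC q (m - 1) b (a * q) c d) *
          monicAW q (a * q) (b * q) c d (m - 2)) := fun m => by
    rw [monicAW_shift_a hq0 hq h, monicAW_shift_b hq0 hq hA, monicAW_shift_b hq0 hq hA (m - 1),
      show m - 1 - 1 = m - 2 by ring]
  have s2 : ∀ m, monicAW q (a * q) (b * q) c d m =
      monicAW q (a * q) (b * q) (c * q) (d * q) m -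
      C (1 / 2 * coeffC q m d (c * q) (a * q) (b * q)) *
        monicAW q (a * q) (b * q) (c * q) (d * q) (m - 1) -
      C (1 / 2 * coeffC q m c d (a * q) (b * q)) *
        (monicAW q (a * q) (b * q) (c * q) (d * q) (m - 1) -
        C (1 / 2 * coeffC q (m - 1) d (c * q) (a * q) (b * q)) *
          monicAW q (a * q) (b * q) (c * q) (d * q) (m - 2)) := fun m => by
    rw [monicAW_shift_c hq0 hq hB, monicAW_shift_d hq0 hq hC, monicAW_shift_d hq0 hq hC (m - 1),
      show m - 1 - 1 = m - 2 by ring]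
    simp only [coeffC_rotate q _ c (a * q) (b * q) d,
      coeffC_rotate q _ d (a * q) (b * q) (c * q)]
  rw [s1, s2 n, s2 (n - 1), s2 (n - 2), hIcc]
  simp only [show n - 1 - 1 = n - 2 by ring, show n - 1 - 2 = n - 3 by ring,
    show n - 2 - 1 = n - 3 by ring, show n - 2 - 2 = n - 4 by ring]
  rw [Finset.sum_insert (by decide), Finset.sum_insert (by decide), Finset.sum_insert (by decide),
    Finset.sum_insert (by decide), Finset.sum_singleton]
  simp only [show n + -2 = n - 2 by ring, show n + -1 = n - 1 by ring, add_zero,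
    show n - 2 - 1 = n - 3 by ring, show n - 2 - 2 = n - 4 by ring,
    show n - 1 - 1 = n - 2 by ring, show n - 1 - 2 = n - 3 by ring,
    show n + 1 - 1 = n by ring, show n + 1 - 2 = n - 1 by ring,
    show n + 2 - 1 = n + 1 by ring, show n + 2 - 2 = n by ring]
  refine Polynomial.funext fun x => ?_
  simp only [eval_add, eval_sub, eval_mul, eval_C]
  generalize eval x (monicAW q (a * q) (b * q) (c * q) (d * q) n) = p0
  generalize eval x (monicAW q (a * q) (b * q) (c * q) (d * q) (n - 1)) = p1
  generalize eval x (monicAW q (a * q) (b * q) (c * q) (d * q) (n - 2)) = p2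
  generalize eval x (monicAW q (a * q) (b * q) (c * q) (d * q) (n - 3)) = p3
  generalize eval x (monicAW q (a * q) (b * q) (c * q) (d * q) (n - 4)) = p4
  -- The equation for b_{n,n+2-i} matches the coefficients of P_{n-i}(aq, bq, cq, dq); its
  -- normalising factor (-2)^i undoes the factors -½ collected from the shifts.
  linear_combination -p0 * e2 + p1 / 2 * e1 - p2 / 4 * e0 + p3 / 8 * f1 - p4 / 16 * f2

end AskeyWilson

theorem proposition5p3 (q r a b c d : ℂ) (hr : r ^ 2 = q) (hq0 : q ≠ 0)
    (hq : ∀ k : ℕ, 1 ≤ k → q ^ k ≠ 1) (ha : a ≠ 0)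
    (hab : ∀ k : ℕ, a * b * q ^ k ≠ 1) (hac : ∀ k : ℕ, a * c * q ^ k ≠ 1)
    (had : ∀ k : ℕ, a * d * q ^ k ≠ 1) (habcd : ∀ k : ℕ, a * b * c * d * q ^ k ≠ 1) (n : ℕ) :
    (∃ β : ℤ → ℂ, IsSecondStructureCoeff q r a b c d n β) ∧
      ∀ β : ℤ → ℂ, IsSecondStructureCoeff q r a b c d n β →
        monicAW q a b c d n =
          ∑ j ∈ Finset.Icc (-2 : ℤ) 2,
            C (β (n + j)) * awD r (awD r (monicAW q a b c d (n + j))) := by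
  subst hr
  have hr0 : r ≠ 0 := fun h => hq0 (by rw [h]; norm_num)
  exact ⟨exists_isSecondStructureCoeff hr0 hq a b c d (Int.natCast_nonneg n), fun β hβ =>
    monicAW_eq_of_isSecondStructureCoeff hr0 hq ⟨ha, hab, hac, had, habcd⟩ n hβ⟩
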